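/- Let $N\ge 1$ be an integer. For real coefficients $a=(a_1,\dots,a_N)$ with $\sum_{j=1}^N a_j=1$ put $$C_a(t)=\sum_{j=1}^N a_j\cos(2j-1)t,\qquad S_a(t)=\sum_{j=1}^N a_j\sin(2j-1)t,\qquad P_a(t)=\sum_{j=1}^N a_j e^{-i(2j-1)t},$$ and define $$I(N)=\sup_{\sum a_j=1}\ \min\left\{\operatorname{Re}\left(P_a(t)^2\right): t\in[0,2\pi],\ \operatorname{Im}\left(P_a(t)^2\right)=0\right\},$$ $$J(N)=\inf_{\sum a_j=1}\ \max\left\{|S_a(t)|: t\in[0,\tfrac{\pi}{2}],\ C_a(t)=0\right\}.$$ Then, for every such $a$, the inner minimum and the inner maximum exist, and $$-I(N)=J(N)^2=\frac1{N^2}.$$ -/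

import Mathlib

namespace CycleStabilization

/-- `C(t) = ∑_{j=1}^N a_j cos((2j-1)t)`. The coefficients `a_1, …, a_N` are indexed by `Fin N`,
that is, from `0`, so `a_j` is `a (j-1)` and the frequencies `1, 3, …, 2N-1` read `2j+1`. -/
noncomputable def C {N : ℕ} (a : Fin N → ℝ) (t : ℝ) : ℝ :=
  ∑ j : Fin N, a j * Real.cos ((2 * (j : ℝ) + 1) * t)

/-- `S(t) = ∑_{j=1}^N a_j sin((2j-1)t)`, with frequencies `1, 3, …, 2N-1`. -/
noncomputable def S {N : ℕ} (a : Fin N → ℝ) (t : ℝ) : ℝ :=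
  ∑ j : Fin N, a j * Real.sin ((2 * (j : ℝ) + 1) * t)

/-- `P(t) = ∑_{j=1}^N a_j e^{-i(2j-1)t}`, with frequencies `1, 3, …, 2N-1`. -/
noncomputable def P {N : ℕ} (a : Fin N → ℝ) (t : ℝ) : ℂ :=
  ∑ j : Fin N, (a j : ℂ) * Complex.exp (-Complex.I * ((2 * (j : ℂ) + 1) * (t : ℂ)))

/-- The values `|S(t)|` at the zeros `t ∈ [0, π/2]` of `C`. -/
def zeroValues {N : ℕ} (a : Fin N → ℝ) : Set ℝ :=
  {y | ∃ t ∈ Set.Icc (0 : ℝ) (Real.pi / 2), C a t = 0 ∧ y = |S a t|}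

/-- The values `Re (P(t)²)` at the points `t ∈ [0, 2π]` where `Im (P(t)²) = 0`. -/
def Omega {N : ℕ} (a : Fin N → ℝ) : Set ℝ :=
  {y | ∃ t ∈ Set.Icc (0 : ℝ) (2 * Real.pi), (P a t ^ 2).im = 0 ∧ y = (P a t ^ 2).re}

/-- `I(N) = sup_{∑ a_j = 1} min Omega(a)`. -/
noncomputable def I (N : ℕ) : ℝ :=
  sSup {m | ∃ a : Fin N → ℝ, ∑ j, a j = 1 ∧ IsLeast (Omega a) m}

/-- `J(N) = inf_{∑ a_j = 1} max {|S(t)| : t ∈ [0, π/2], C(t) = 0}`. -/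
noncomputable def J (N : ℕ) : ℝ :=
  sInf {m | ∃ a : Fin N → ℝ, ∑ j, a j = 1 ∧ IsGreatest (zeroValues a) m}

end CycleStabilization

/-! Where `C` vanishes, `P ^ 2` equals `-S ^ 2`; where `S` vanishes it is nonnegative. So the
minimum of `Omega` is minus the square of the maximum of `zeroValues`, and everything reduces to `J
N = 1 / N`.

Lower bound (`exists_zero_le_S`): in `x = cot t`, `C` becomes a monic polynomial `q` of odd degree,
whose real roots `y = cot τ` are zeros of `C`. `Polynomial.Monic.exists_weights_on_roots` yields
convex weights for which `q(x) ∑ w_y / (x - y) ≥ 0`. Hence `ψ(t) = ∑ w_y sin τ_y · C(t) / sin (τ_y -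
t)` is a nonnegative trigonometric polynomial with `ψ(0) = 1`. Its frequencies are even and below
`2N`, so its mean is its average over the `N` nodes `nπ/N`. That mean is `∑ w_y sin τ_y S(τ_y)`, and
it is at least `ψ(0) / N = 1 / N`; hence some `S(τ_y) ≥ 1 / N`.

Upper bound (`exists_isGreatest_near`): normalised odd Fejér coefficients, perturbed by a small
multiple of `cos t`, leave `π/2` as the only zero, with value tending to `1 / N`. -/

/-! ### Real polynomials: sign-preserving weights on the roots. -/

open Polynomial in
/-- A monic real polynomial without real roots is positive. -/
theorem Polynomial.Monic.eval_pos_of_forall_not_isRoot {p : ℝ[X]} (hp : p.Monic)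
    (h : ∀ x, ¬ p.IsRoot x) (x : ℝ) : 0 < p.eval x := by
  by_contra hx
  rcases Nat.eq_zero_or_pos p.natDegree with h0 | h0
  · rw [hp.natDegree_eq_zero.mp h0] at hx
    simp at hx
  have ht := p.tendsto_atTop_of_leadingCoeff_nonneg (natDegree_pos_iff_degree_pos.mp h0)
    (by rw [hp.leadingCoeff]; exact zero_le_one)
  obtain ⟨y, hy⟩ := (ht.eventually_ge_atTop 0).exists
  obtain ⟨z, hz⟩ := mem_range_of_exists_le_of_exists_ge p.continuous ⟨x, not_lt.mp hx⟩ ⟨y, hy⟩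
  exact h z hz

open Polynomial in
/-- A monic polynomial with a real root factors off its largest root. -/
theorem Polynomial.Monic.exists_eq_mul_of_isRoot {p : ℝ[X]} (hp : p.Monic)
    (h : ∃ x, p.IsRoot x) :
    ∃ (α : ℝ) (g : ℝ[X]), p = (X - C α) * g ∧ g.Monic ∧ p.natDegree = g.natDegree + 1 ∧
      (∀ x, p.IsRoot x → x ≤ α) := by
  obtain ⟨x, hx⟩ := h
  have hne : p.roots.toFinset.Nonempty := ⟨x, by simpa [hp.ne_zero] using hx⟩
  have hm := p.roots.toFinset.max'_mem hne
  set α := p.roots.toFinset.max' hne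
  have hr : p.IsRoot α := by simpa [hp.ne_zero] using hm
  obtain ⟨g, hg⟩ := dvd_iff_isRoot.mpr hr
  have hgm : g.Monic := (monic_X_sub_C α).of_mul_monic_left (hg ▸ hp)
  refine ⟨α, g, hg, hgm, ?_, fun y hy => Finset.le_max' _ _ (by simpa [hp.ne_zero] using hy)⟩
  rw [hg, (monic_X_sub_C α).natDegree_mul hgm, natDegree_X_sub_C, add_comm]

open Polynomial in
/-- For a monic real polynomial `q` of odd degree some convex combination of the functions
`1 / (x - y)`, over real roots `y` of `q`, has the sign of `q` everywhere. -/
theorem Polynomial.Monic.exists_weights_on_roots {q : ℝ[X]} (hq : q.Monic)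
    (hodd : Odd q.natDegree) :
    ∃ (s : Finset ℝ) (w : ℝ → ℝ), (∀ y ∈ s, q.IsRoot y) ∧ (∀ y ∈ s, 0 ≤ w y) ∧
      ∑ y ∈ s, w y = 1 ∧ ∀ x ∉ s, 0 ≤ q.eval x * ∑ y ∈ s, w y / (x - y) := by
  induction hn : q.natDegree using Nat.strong_induction_on generalizing q with
  | _ n ih =>
  have hroot : ∃ x, q.IsRoot x := by
    by_contra! hno
    have hpos := hq.eval_pos_of_forall_not_isRoot hno
    -- Odd degree makes `-q(-x)` monic as well, so a rootless `q` would have `q` and `-q(-x)` both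
    -- positive, which is absurd at `0`.
    have hm : (-(q.comp (-X))).Monic := by
      rw [Monic, leadingCoeff_neg, leadingCoeff_comp (by simp), hq.leadingCoeff]
      simp [hodd.neg_one_pow]
    have := hm.eval_pos_of_forall_not_isRoot (fun x hx => (hpos (-x)).ne' (by
      simpa [eval_comp] using hx)) 0
    have h0 := hpos 0
    simp [eval_comp] at this
    linarith
  obtain ⟨α, h, hqh, hh, hdh, hα⟩ := hq.exists_eq_mul_of_isRoot hroot
  by_cases hhr : ∃ x, h.IsRoot x
  -- Removing the two largest roots `β ≤ α` keeps the degree odd, so induction applies to `g`.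
  · obtain ⟨β, g, hhg, hg, hdg, hβ⟩ := hh.exists_eq_mul_of_isRoot hhr
    have hgodd : Odd g.natDegree := by
      rw [hdh, hdg] at hodd
      simpa [parity_simps] using hodd
    obtain ⟨s, w, hs, hw, hsum, hpos⟩ := ih g.natDegree (by omega) hg hgodd rfl
    have hβα : β ≤ α := hα β (by simp [hqh, hhg, IsRoot])
    have hsβ : ∀ y ∈ s, y ≤ β := fun y hy => hβ y (by
      have := hs y hy
      simp only [IsRoot] at this
      simp [hhg, IsRoot, this])
    have hsq : ∀ y ∈ s, q.IsRoot y := fun y hy => by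
      have := hs y hy
      simp only [IsRoot] at this
      simp [hqh, hhg, IsRoot, this]
    have hev : ∀ x, q.eval x = (x - α) * ((x - β) * g.eval x) := by
      intro x; simp [hqh, hhg]
    rcases hβα.eq_or_lt with rfl | hlt
    · refine ⟨s, w, hsq, hw, hsum, fun x hx => ?_⟩
      have := mul_nonneg (mul_self_nonneg (x - β)) (hpos x hx)
      rw [hev]
      linarith
    · have hαs : α ∉ s := fun hmem => absurd (hsβ α hmem) (not_le.mpr hlt)
      have hlt' : ∀ y ∈ s, 0 < α - y := fun y hy => by linarith [hsβ y hy]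
      have hne : ∀ y ∈ s, y ≠ α := fun y hy => by rintro rfl; exact hαs hy
      -- `c` and `v` are the residues in the partial fractions of `(x - β) / (x - α) * ∑ w y / (x -
      -- y)`. They are nonnegative because `y ≤ β < α`. Multiplied by `q`, this function is `(x - β)
      -- ^ 2` times the nonnegative product known for `g`.
      set c := (α - β) * ∑ y ∈ s, w y / (α - y) with hc
      set v : ℝ → ℝ := fun y => if y = α then c else w y * ((β - y) / (α - y)) with hv
      have hvα : v α = c := by simp [hv]
      have hvs : ∀ y ∈ s, v y = w y * ((β - y) / (α - y)) := fun y hy => by simp [hv, hne y hy]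
      refine ⟨insert α s, v, ?_, ?_, ?_, ?_⟩
      · intro y hy
        rcases Finset.mem_insert.mp hy with rfl | hy
        · simp [IsRoot, hev]
        · exact hsq y hy
      · intro y hy
        rcases Finset.mem_insert.mp hy with rfl | hy
        · rw [hvα]
          exact mul_nonneg (by linarith)
            (Finset.sum_nonneg fun y hy => div_nonneg (hw y hy) (hlt' y hy).le)
        · rw [hvs y hy]
          exact mul_nonneg (hw y hy) (div_nonneg (by linarith [hsβ y hy]) (hlt' y hy).le)
      · rw [Finset.sum_insert hαs, hvα, hc, Finset.mul_sum, ← Finset.sum_add_distrib, ← hsum]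
        refine Finset.sum_congr rfl fun y hy => ?_
        rw [hvs y hy]
        have := (hlt' y hy).ne'
        field_simp
        ring
      · intro x hx
        obtain ⟨hxα, hxs⟩ := not_or.mp (Finset.mem_insert.not.mp hx)
        have hxα' : x - α ≠ 0 := sub_ne_zero.mpr hxα
        have key : ∑ y ∈ insert α s, v y / (x - y)
            = (x - β) / (x - α) * ∑ y ∈ s, w y / (x - y) := by
          rw [Finset.sum_insert hαs, hvα, hc, Finset.mul_sum, Finset.sum_div, Finset.mul_sum,
            ← Finset.sum_add_distrib]
          refine Finset.sum_congr rfl fun y hy => ?_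
          rw [hvs y hy]
          have h1 := (hlt' y hy).ne'
          have h2 : x - y ≠ 0 := sub_ne_zero.mpr (by rintro rfl; exact hxs hy)
          field_simp
          ring
        have := mul_nonneg (mul_self_nonneg (x - β)) (hpos x hxs)
        rw [key, hev]
        calc 0 ≤ _ := this
          _ = _ := by field_simp
  · refine ⟨{α}, fun _ => 1, ?_, by simp, by simp, ?_⟩
    · simp [hqh, IsRoot]
    · intro x hx
      have hxα : x - α ≠ 0 := sub_ne_zero.mpr (by simpa using hx)
      have := hh.eval_pos_of_forall_not_isRoot (not_exists.mp hhr) x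
      simp only [hqh, eval_mul, eval_sub, eval_X, eval_C, Finset.sum_singleton]
      calc 0 ≤ h.eval x := this.le
        _ = _ := by field_simp

namespace CycleStabilization

/-! ### The cotangent substitution. -/

open Polynomial in
/-- `cos (m t)` and `sin (m t)` are `sin t ^ m` times polynomials in `cot t`. -/
theorem exists_polynomial_cot (m : ℕ) : ∃ p r : ℝ[X], p.natDegree ≤ m ∧ p.coeff m = 1 ∧
    r.natDegree ≤ m ∧ r.coeff m = 0 ∧ ∀ t : ℝ, Real.sin t ≠ 0 →
      Real.sin t ^ m * p.eval (Real.cos t / Real.sin t) = Real.cos (m * t) ∧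
      Real.sin t ^ m * r.eval (Real.cos t / Real.sin t) = Real.sin (m * t) := by
  induction m with
  | zero => exact ⟨1, 0, by simp⟩
  | succ m ih =>
    obtain ⟨p, r, hp, hp1, hr, hr0, h⟩ := ih
    refine ⟨X * p - r, p + X * r, ?_, ?_, ?_, ?_, fun t ht => ?_⟩
    · refine (natDegree_sub_le _ _).trans (max_le ?_ (by omega))
      exact natDegree_mul_le.trans (by rw [natDegree_X]; omega)
    · rw [coeff_sub, coeff_X_mul, hp1, coeff_eq_zero_of_natDegree_lt (by omega), sub_zero]
    · refine (natDegree_add_le _ _).trans (max_le (by omega) ?_)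
      exact natDegree_mul_le.trans (by rw [natDegree_X]; omega)
    · rw [coeff_add, coeff_X_mul, hr0, coeff_eq_zero_of_natDegree_lt (by omega), zero_add]
    · obtain ⟨h1, h2⟩ := h t ht
      push_cast
      rw [add_mul, one_mul, Real.cos_add, Real.sin_add, ← h1, ← h2]
      simp only [eval_sub, eval_add, eval_mul, eval_X]
      constructor <;> field_simp <;> ring

open Polynomial in
/-- If the coefficients sum to one, then `C a t` is `sin t ^ (2N-1)` times a monic polynomial of
degree `2N-1` in `cot t`. -/
theorem exists_monic_cot {N : ℕ} (hN : 1 ≤ N) (a : Fin N → ℝ) (ha : ∑ j, a j = 1) :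
    ∃ q : ℝ[X], q.Monic ∧ q.natDegree = 2 * (N - 1) + 1 ∧ ∀ t : ℝ, Real.sin t ≠ 0 →
      C a t = Real.sin t ^ (2 * (N - 1) + 1) * q.eval (Real.cos t / Real.sin t) := by
  choose p r hp hp1 _ _ h using exists_polynomial_cot
  have hd : ∀ j : Fin N, ((X ^ 2 + 1 : ℝ[X]) ^ (N - 1 - (j : ℕ))).natDegree
      = 2 * (N - 1 - (j : ℕ)) := fun j => by
    rw [natDegree_pow, ← C_1, natDegree_X_pow_add_C, mul_comm]
  have hm : ∀ j : Fin N, ((X ^ 2 + 1 : ℝ[X]) ^ (N - 1 - (j : ℕ))).Monic := fun j => by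
    rw [← C_1]; exact (monic_X_pow_add_C 1 two_ne_zero).pow _
  -- Since `sin² t (cot² t + 1) = 1`, the powers of `X ^ 2 + 1` bring all frequencies to the common
  -- degree `2N - 1` without changing values.
  set q : ℝ[X] := ∑ j : Fin N,
    Polynomial.C (a j) * (p (2 * j + 1) * (X ^ 2 + 1) ^ (N - 1 - (j : ℕ))) with hq
  have hle : q.natDegree ≤ 2 * (N - 1) + 1 := by
    refine natDegree_sum_le_of_forall_le _ _ fun j _ => ?_
    refine (natDegree_C_mul_le _ _).trans (natDegree_mul_le.trans ?_)
    have := hp (2 * j + 1)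
    rw [hd]
    omega
  have hco : q.coeff (2 * (N - 1) + 1) = 1 := by
    rw [hq, finsetSum_coeff, ← ha]
    refine Finset.sum_congr rfl fun j _ => ?_
    have e : 2 * (N - 1) + 1 = (2 * j + 1) + 2 * (N - 1 - (j : ℕ)) := by omega
    rw [coeff_C_mul, e, coeff_mul_add_eq_of_natDegree_le (hp _) (hd j).le, hp1, ← hd j,
      (hm j).coeff_natDegree, mul_one, mul_one]
  have hmon := monic_of_natDegree_le_of_coeff_eq_one _ hle hco
  refine ⟨q, hmon, le_antisymm hle (le_natDegree_of_ne_zero (by simp [hco])), fun t ht => ?_⟩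
  simp only [C, hq, eval_finsetSum, Finset.mul_sum]
  refine Finset.sum_congr rfl fun j _ => ?_
  have e : 2 * (N - 1) + 1 = (2 * j + 1) + 2 * (N - 1 - (j : ℕ)) := by omega
  have h1 := (h (2 * j + 1) t ht).1
  push_cast at h1
  have h2 : Real.sin t ^ 2 * ((Real.cos t / Real.sin t) ^ 2 + 1) = 1 := by
    field_simp
    linarith [Real.sin_sq_add_cos_sq t]
  have h3 : Real.sin t ^ (2 * (N - 1 - (j : ℕ))) *
      ((Real.cos t / Real.sin t) ^ 2 + 1) ^ (N - 1 - (j : ℕ)) = 1 := by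
    rw [pow_mul, ← mul_pow, h2, one_pow]
  rw [← h1, e, pow_add _ (2 * (j : ℕ) + 1)]
  simp only [eval_mul, eval_C, eval_pow, eval_add, eval_X, eval_one]
  linear_combination -(a j * Real.sin t ^ (2 * (j : ℕ) + 1) *
    (p (2 * j + 1)).eval (Real.cos t / Real.sin t)) * h3

/-! ### Division by `sin (τ - t)` and averages over equispaced nodes. -/

/-- The trigonometric polynomial `C a t / sin (τ - t)`, where `τ` is a zero of `C a`. -/
noncomputable def quotient {N : ℕ} (a : Fin N → ℝ) (τ t : ℝ) : ℝ :=
  ∑ j : Fin N, a j *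
    (Real.sin ((2 * (j : ℝ) + 1) * τ) *
        (1 + 2 * ∑ l ∈ Finset.range j, Real.cos (2 * ((l : ℝ) + 1) * (t - τ))) +
      2 * Real.cos ((2 * (j : ℝ) + 1) * τ) *
        ∑ l ∈ Finset.range j, Real.sin (2 * ((l : ℝ) + 1) * (t - τ)))

theorem sin_mul_dirichlet (u : ℝ) (j : ℕ) :
    Real.sin u * (1 + 2 * ∑ l ∈ Finset.range j, Real.cos (2 * ((l : ℝ) + 1) * u))
      = Real.sin ((2 * (j : ℝ) + 1) * u) := by
  induction j with
  | zero => simp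
  | succ j ih =>
    rw [Finset.sum_range_succ, mul_add 2, ← add_assoc, mul_add, ih]
    have e1 : (2 * (j : ℝ) + 1) * u = 2 * ((j : ℝ) + 1) * u - u := by ring
    have e2 : (2 * ((j + 1 : ℕ) : ℝ) + 1) * u = 2 * ((j : ℝ) + 1) * u + u := by push_cast; ring
    rw [e1, e2, Real.sin_sub, Real.sin_add]
    ring

theorem sin_mul_conj_dirichlet (u : ℝ) (j : ℕ) :
    Real.sin u * (2 * ∑ l ∈ Finset.range j, Real.sin (2 * ((l : ℝ) + 1) * u))
      = Real.cos u - Real.cos ((2 * (j : ℝ) + 1) * u) := by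
  induction j with
  | zero => simp
  | succ j ih =>
    rw [Finset.sum_range_succ, mul_add 2, mul_add, ih]
    have e1 : (2 * (j : ℝ) + 1) * u = 2 * ((j : ℝ) + 1) * u - u := by ring
    have e2 : (2 * ((j + 1 : ℕ) : ℝ) + 1) * u = 2 * ((j : ℝ) + 1) * u + u := by push_cast; ring
    rw [e1, e2, Real.cos_sub, Real.cos_add]
    ring

/-- Expanding each `cos ((2j+1)t)` about `τ` lets the two Dirichlet kernels perform the division;
the leftover `cos (t - τ)` terms add up to a multiple of `C a τ = 0`. -/
theorem sin_mul_quotient {N : ℕ} (a : Fin N → ℝ) {τ : ℝ} (hτ : C a τ = 0) (t : ℝ) :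
    Real.sin (τ - t) * quotient a τ t = C a t := by
  have h : Real.sin (t - τ) * quotient a τ t = Real.cos (t - τ) * C a τ - C a t := by
    rw [quotient, C, C, Finset.mul_sum, Finset.mul_sum, ← Finset.sum_sub_distrib]
    refine Finset.sum_congr rfl fun j _ => ?_
    have h1 := sin_mul_dirichlet (t - τ) j
    have h2 := sin_mul_conj_dirichlet (t - τ) j
    have e : (2 * (j : ℝ) + 1) * t = (2 * (j : ℝ) + 1) * (t - τ) + (2 * (j : ℝ) + 1) * τ := by ring
    rw [e, Real.cos_add]
    linear_combination a j * Real.sin ((2 * (j : ℝ) + 1) * τ) * h1 +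
      a j * Real.cos ((2 * (j : ℝ) + 1) * τ) * h2
  rw [← neg_sub t τ, Real.sin_neg]
  rw [hτ] at h
  linarith

theorem continuous_quotient {N : ℕ} (a : Fin N → ℝ) (τ : ℝ) : Continuous (quotient a τ) := by
  unfold quotient
  fun_prop

/-- Exponential sums over `N` equispaced nodes vanish for frequencies below `N`. -/
theorem sum_exp_nodes {N l : ℕ} (hl : 0 < l) (hlN : l < N) (τ : ℝ) :
    ∑ n ∈ Finset.range N,
      Complex.exp (((2 * (l : ℝ) * ((n : ℝ) * Real.pi / N - τ) : ℝ) : ℂ) * Complex.I) = 0 := by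
  have hN : N ≠ 0 := by omega
  have hζ := Complex.isPrimitiveRoot_exp N hN
  have hne : Complex.exp (2 * Real.pi * Complex.I / N) ^ l ≠ 1 :=
    hζ.pow_ne_one_of_pos_of_lt hl.ne' hlN
  have hgeom : ∑ n ∈ Finset.range N, (Complex.exp (2 * Real.pi * Complex.I / N) ^ l) ^ n = 0 := by
    have := mul_geom_sum (Complex.exp (2 * Real.pi * Complex.I / N) ^ l) N
    rw [← pow_mul, mul_comm l N, pow_mul, hζ.pow_eq_one, one_pow, sub_self] at this
    exact (mul_eq_zero.mp this).resolve_left (sub_ne_zero.mpr hne)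
  have : ∀ n ∈ Finset.range N,
      Complex.exp (((2 * (l : ℝ) * ((n : ℝ) * Real.pi / N - τ) : ℝ) : ℂ) * Complex.I)
      = Complex.exp (-(2 * l * τ * Complex.I)) *
        (Complex.exp (2 * Real.pi * Complex.I / N) ^ l) ^ n := by
    intro n _
    rw [← Complex.exp_nat_mul, ← Complex.exp_nat_mul, ← Complex.exp_add]
    congr 1
    push_cast
    ring
  rw [Finset.sum_congr rfl this, ← Finset.mul_sum, hgeom, mul_zero]

theorem sum_cos_nodes {N l : ℕ} (hl : 0 < l) (hlN : l < N) (τ : ℝ) :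
    ∑ n ∈ Finset.range N, Real.cos (2 * (l : ℝ) * ((n : ℝ) * Real.pi / N - τ)) = 0 := by
  have := congrArg Complex.re (sum_exp_nodes hl hlN τ)
  simpa only [Complex.re_sum, Complex.exp_ofReal_mul_I_re, Complex.zero_re] using this

theorem sum_sin_nodes {N l : ℕ} (hl : 0 < l) (hlN : l < N) (τ : ℝ) :
    ∑ n ∈ Finset.range N, Real.sin (2 * (l : ℝ) * ((n : ℝ) * Real.pi / N - τ)) = 0 := by
  have := congrArg Complex.im (sum_exp_nodes hl hlN τ)
  simpa only [Complex.im_sum, Complex.exp_ofReal_mul_I_im, Complex.zero_im] using this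

/-- The average of `quotient a τ` over the nodes `nπ/N` is the conjugate polynomial at `τ`. -/
theorem sum_quotient_nodes {N : ℕ} (a : Fin N → ℝ) (τ : ℝ) :
    ∑ n ∈ Finset.range N, quotient a τ ((n : ℝ) * Real.pi / N) = N * S a τ := by
  unfold quotient S
  rw [Finset.sum_comm, Finset.mul_sum]
  refine Finset.sum_congr rfl fun j _ => ?_
  -- The frequencies are `2(l+1)` with `0 < l + 1 ≤ j < N`, so only the constant terms `a j sin
  -- ((2j+1)τ)` survive averaging.
  have hc : ∑ n ∈ Finset.range N, ∑ l ∈ Finset.range j,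
      Real.cos (2 * ((l : ℝ) + 1) * ((n : ℝ) * Real.pi / N - τ)) = 0 := by
    rw [Finset.sum_comm]
    refine Finset.sum_eq_zero fun l hl => ?_
    have := sum_cos_nodes (N := N) (l := l + 1) (by omega)
      (by have := Finset.mem_range.mp hl; omega) τ
    exact_mod_cast this
  have hs : ∑ n ∈ Finset.range N, ∑ l ∈ Finset.range j,
      Real.sin (2 * ((l : ℝ) + 1) * ((n : ℝ) * Real.pi / N - τ)) = 0 := by
    rw [Finset.sum_comm]
    refine Finset.sum_eq_zero fun l hl => ?_
    have := sum_sin_nodes (N := N) (l := l + 1) (by omega)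
      (by have := Finset.mem_range.mp hl; omega) τ
    exact_mod_cast this
  rw [← Finset.mul_sum, Finset.sum_add_distrib, ← Finset.mul_sum, ← Finset.mul_sum, hs,
    Finset.sum_add_distrib, ← Finset.mul_sum, hc]
  simp
  ring

/-! ### Reflection in `π/2` and the lower bound. -/

theorem C_pi_sub {N : ℕ} (a : Fin N → ℝ) (t : ℝ) : C a (Real.pi - t) = -C a t := by
  rw [C, C, ← Finset.sum_neg_distrib]
  refine Finset.sum_congr rfl fun j _ => ?_
  have e : (2 * (j : ℝ) + 1) * (Real.pi - t)
      = Real.pi - (2 * (j : ℝ) + 1) * t + (j : ℕ) * (2 * Real.pi) := by ring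
  rw [e, Real.cos_add_nat_mul_two_pi, Real.cos_pi_sub, mul_neg]

theorem S_pi_sub {N : ℕ} (a : Fin N → ℝ) (t : ℝ) : S a (Real.pi - t) = S a t := by
  rw [S, S]
  refine Finset.sum_congr rfl fun j _ => ?_
  have e : (2 * (j : ℝ) + 1) * (Real.pi - t)
      = Real.pi - (2 * (j : ℝ) + 1) * t + (j : ℕ) * (2 * Real.pi) := by ring
  rw [e, Real.sin_add_nat_mul_two_pi, Real.sin_pi_sub]

/-- Every point of the real line is `cot τ` for some `τ ∈ (0, π)`. -/
theorem exists_cot_eq (x : ℝ) :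
    ∃ τ ∈ Set.Ioo 0 Real.pi, Real.cos τ / Real.sin τ = x := by
  refine ⟨Real.pi / 2 - Real.arctan x, ⟨?_, ?_⟩, ?_⟩
  · linarith [Real.arctan_lt_pi_div_two x]
  · linarith [Real.neg_pi_div_two_lt_arctan x]
  · rw [Real.cos_pi_div_two_sub, Real.sin_pi_div_two_sub, ← Real.tan_eq_sin_div_cos,
      Real.tan_arctan]

/-- Some zero of `C a` in `(0, π)` carries a value of `S a` of at least `1/N`. -/
theorem exists_zero_le_S {N : ℕ} (hN : 1 ≤ N) (a : Fin N → ℝ) (ha : ∑ j, a j = 1) :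
    ∃ τ ∈ Set.Ioo 0 Real.pi, C a τ = 0 ∧ 1 / (N : ℝ) ≤ S a τ := by
  obtain ⟨q, hq, hdeg, hC⟩ := exists_monic_cot hN a ha
  obtain ⟨s, w, hs, hw, hsum, hpos⟩ :=
    hq.exists_weights_on_roots (by rw [hdeg]; exact odd_two_mul_add_one _)
  choose τ hτ hcot using exists_cot_eq
  have hsin : ∀ y, 0 < Real.sin (τ y) := fun y => Real.sin_pos_of_mem_Ioo (hτ y)
  have hzero : ∀ y ∈ s, C a (τ y) = 0 := fun y hy => by
    rw [hC _ (hsin y).ne', hcot, hs y hy, mul_zero]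
  -- The factor `sin (τ y)` makes every term equal to `w y` at `t = 0` and turns `1 / sin (τ y - t)`
  -- into `1 / (sin t (cot t - y))`.
  set ψ : ℝ → ℝ := fun t => ∑ y ∈ s, w y * Real.sin (τ y) * quotient a (τ y) t with hψ
  have hψc : Continuous ψ :=
    continuous_finsetSum _ fun y _ => (continuous_quotient a (τ y)).const_mul _
  have hψ0 : ψ 0 = 1 := by
    rw [hψ, ← hsum]
    refine Finset.sum_congr rfl fun y hy => ?_
    have h := sin_mul_quotient a (hzero y hy) 0
    have hC0 : C a 0 = 1 := by simp [C, ha]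
    rw [sub_zero, hC0] at h
    rw [mul_assoc, h, mul_one]
  have hcount : ∀ u : ℝ, {t | Real.sin (t - u) = 0}.Countable := fun u => by
    refine (Set.countable_range fun n : ℤ => (n : ℝ) * Real.pi + u).mono ?_
    intro t ht
    obtain ⟨n, hn⟩ := Real.sin_eq_zero_iff.mp ht
    exact ⟨n, by simp only; linarith⟩
  -- Off this countable set all divisions are legitimate; nonnegativity then extends by density and
  -- continuity.
  set bad : Set ℝ := {t | Real.sin (t - 0) = 0} ∪ ⋃ y ∈ s, {t | Real.sin (t - τ y) = 0} with hbad
  have hdense : Dense badᶜ :=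
    ((hcount 0).union (s.countable_toSet.biUnion fun y _ => hcount (τ y))).dense_compl ℝ
  have hψnn : ∀ t, 0 ≤ ψ t := by
    have hcl : IsClosed {t | 0 ≤ ψ t} := isClosed_le continuous_const hψc
    intro t
    suffices hsub : badᶜ ⊆ {t | 0 ≤ ψ t} from hcl.closure_subset_iff.mpr hsub (hdense t)
    intro t ht
    simp only [hbad, Set.mem_compl_iff, Set.mem_union, Set.mem_iUnion, Set.mem_ofPred_eq, not_or,
      not_exists, sub_zero] at ht
    obtain ⟨ht0, hts⟩ := ht
    have hdiff : ∀ y, Real.sin (τ y - t)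
        = Real.sin (τ y) * Real.sin t * (Real.cos t / Real.sin t - y) := fun y => by
      have := (hsin y).ne'
      nth_rewrite 3 [← hcot y]
      rw [Real.sin_sub]
      field_simp
    have hne : ∀ y ∈ s, Real.cos t / Real.sin t - y ≠ 0 := fun y hy h0 => hts y hy (by
      rw [← neg_sub, Real.sin_neg, hdiff, h0, mul_zero, neg_zero])
    have hval : ψ t = (Real.sin t ^ (N - 1)) ^ 2 * (q.eval (Real.cos t / Real.sin t) *
        ∑ y ∈ s, w y / (Real.cos t / Real.sin t - y)) := by
      rw [hψ, ← mul_assoc, Finset.mul_sum]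
      refine Finset.sum_congr rfl fun y hy => ?_
      have h := sin_mul_quotient a (hzero y hy) t
      rw [hdiff, hC t ht0, pow_succ, mul_comm 2 (N - 1), pow_mul] at h
      have h3 : Real.sin (τ y) * quotient a (τ y) t * (Real.cos t / Real.sin t - y)
          = (Real.sin t ^ (N - 1)) ^ 2 * q.eval (Real.cos t / Real.sin t) := by
        refine mul_left_cancel₀ ht0 ?_
        linear_combination h
      rw [mul_div_assoc', eq_div_iff (hne y hy)]
      linear_combination w y * h3
    show 0 ≤ ψ t
    rw [hval]
    refine mul_nonneg (sq_nonneg _) (hpos _ fun hmem => hne _ hmem (sub_self _))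
  have hNpos : (0 : ℝ) < N := by exact_mod_cast hN
  have havg : ∑ n ∈ Finset.range N, ψ ((n : ℝ) * Real.pi / N)
      = N * ∑ y ∈ s, w y * Real.sin (τ y) * S a (τ y) := by
    rw [hψ, Finset.sum_comm, Finset.mul_sum]
    refine Finset.sum_congr rfl fun y _ => ?_
    rw [← Finset.mul_sum, sum_quotient_nodes]
    ring
  have hge : 1 ≤ N * ∑ y ∈ s, w y * Real.sin (τ y) * S a (τ y) := by
    rw [← havg, ← hψ0]
    -- The node `n = 0` alone contributes `ψ 0 = 1`.
    have := Finset.single_le_sum (f := fun n : ℕ => ψ ((n : ℝ) * Real.pi / N))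
      (fun n _ => hψnn _) (Finset.mem_range.mpr (by omega : 0 < N))
    simpa using this
  by_contra! hlt
  have hle : ∑ y ∈ s, w y * Real.sin (τ y) * S a (τ y) < 1 / N := by
    obtain ⟨z, hz, hzw⟩ : ∃ z ∈ s, 0 < w z := by
      by_contra! h
      linarith [Finset.sum_nonpos h]
    -- No sign of `S` is needed: `sin τ · S < sin τ / N ≤ 1 / N`.
    have hb : ∀ y ∈ s, Real.sin (τ y) * S a (τ y) < 1 / N := fun y hy => by
      have h1 := hlt _ (hτ y) (hzero y hy)
      have h2 := mul_lt_mul_of_pos_left h1 (hsin y)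
      have h3 := mul_le_mul_of_nonneg_right (Real.sin_le_one (τ y)) (one_div_nonneg.mpr hNpos.le)
      linarith
    calc _ < ∑ y ∈ s, w y * (1 / N) := by
          refine Finset.sum_lt_sum (fun y hy => ?_) ⟨z, hz, ?_⟩
          · rw [mul_assoc]
            exact mul_le_mul_of_nonneg_left (hb y hy).le (hw y hy)
          · rw [mul_assoc]
            exact mul_lt_mul_of_pos_left (hb z hz) hzw
      _ = 1 / N := by rw [← Finset.sum_mul, hsum, one_mul]
  rw [lt_div_iff₀ hNpos] at hle
  linarith

/-! ### Existence of the extrema and the passage from `S` to `P ^ 2`. -/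

theorem continuous_C {N : ℕ} (a : Fin N → ℝ) : Continuous (C a) := by
  unfold C
  fun_prop

theorem continuous_S {N : ℕ} (a : Fin N → ℝ) : Continuous (S a) := by
  unfold S
  fun_prop

theorem C_pi_div_two {N : ℕ} (a : Fin N → ℝ) : C a (Real.pi / 2) = 0 := by
  have := C_pi_sub a (Real.pi / 2)
  rw [sub_half] at this
  linarith

theorem C_two_pi_sub {N : ℕ} (a : Fin N → ℝ) (t : ℝ) : C a (2 * Real.pi - t) = C a t := by
  rw [C, C]
  refine Finset.sum_congr rfl fun j _ => ?_
  have e : (2 * (j : ℝ) + 1) * (2 * Real.pi - t)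
      = ((2 * j + 1 : ℕ) : ℝ) * (2 * Real.pi) - (2 * (j : ℝ) + 1) * t := by push_cast; ring
  rw [e, Real.cos_nat_mul_two_pi_sub]

theorem S_two_pi_sub {N : ℕ} (a : Fin N → ℝ) (t : ℝ) : S a (2 * Real.pi - t) = -S a t := by
  rw [S, S, ← Finset.sum_neg_distrib]
  refine Finset.sum_congr rfl fun j _ => ?_
  have e : (2 * (j : ℝ) + 1) * (2 * Real.pi - t)
      = ((2 * j + 1 : ℕ) : ℝ) * (2 * Real.pi) - (2 * (j : ℝ) + 1) * t := by push_cast; ring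
  rw [e, Real.sin_nat_mul_two_pi_sub, mul_neg]

theorem abs_S_mem_zeroValues_of_le_pi {N : ℕ} (a : Fin N → ℝ) {t : ℝ}
    (ht : t ∈ Set.Icc 0 Real.pi) (h : C a t = 0) : |S a t| ∈ zeroValues a := by
  rcases le_total t (Real.pi / 2) with h2 | h2
  · exact ⟨t, ⟨ht.1, h2⟩, h, rfl⟩
  · exact ⟨Real.pi - t, ⟨by linarith [ht.2], by linarith⟩, by rw [C_pi_sub, h, neg_zero],
      by rw [S_pi_sub]⟩

theorem abs_S_mem_zeroValues {N : ℕ} (a : Fin N → ℝ) {t : ℝ}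
    (ht : t ∈ Set.Icc 0 (2 * Real.pi)) (h : C a t = 0) : |S a t| ∈ zeroValues a := by
  rcases le_total t Real.pi with h2 | h2
  · exact abs_S_mem_zeroValues_of_le_pi a ⟨ht.1, h2⟩ h
  · have := abs_S_mem_zeroValues_of_le_pi a (t := 2 * Real.pi - t)
      ⟨by linarith [ht.2], by linarith⟩ (by rw [C_two_pi_sub, h])
    rwa [S_two_pi_sub, abs_neg] at this

theorem exists_isGreatest_zeroValues {N : ℕ} (a : Fin N → ℝ) :
    ∃ m, IsGreatest (zeroValues a) m := by
  have hK : IsCompact (Set.Icc 0 (Real.pi / 2) ∩ {t | C a t = 0}) :=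
    isCompact_Icc.inter_right (isClosed_eq (continuous_C a) continuous_const)
  have e : zeroValues a = (fun t => |S a t|) '' (Set.Icc 0 (Real.pi / 2) ∩ {t | C a t = 0}) := by
    ext y
    constructor
    · rintro ⟨t, ht, h, rfl⟩
      exact ⟨t, ⟨ht, h⟩, rfl⟩
    · rintro ⟨t, ⟨ht, h⟩, rfl⟩
      exact ⟨t, ht, h, rfl⟩
  rw [e]
  refine (hK.image (continuous_S a).abs).exists_isGreatest (Set.Nonempty.image _ ?_)
  exact ⟨Real.pi / 2, ⟨by positivity, le_rfl⟩, C_pi_div_two a⟩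

theorem P_eq {N : ℕ} (a : Fin N → ℝ) (t : ℝ) : P a t = ⟨C a t, -S a t⟩ := by
  have h : ∀ j : Fin N, (a j : ℂ) * Complex.exp (-Complex.I * ((2 * (j : ℂ) + 1) * (t : ℂ)))
      = ⟨a j * Real.cos ((2 * (j : ℝ) + 1) * t), -(a j * Real.sin ((2 * (j : ℝ) + 1) * t))⟩ := by
    intro j
    have e : -Complex.I * ((2 * (j : ℂ) + 1) * (t : ℂ))
        = ((-((2 * (j : ℝ) + 1) * t) : ℝ) : ℂ) * Complex.I := by push_cast; ring
    rw [e]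
    apply Complex.ext
    · rw [Complex.re_ofReal_mul, Complex.exp_ofReal_mul_I_re, Real.cos_neg]
    · rw [Complex.im_ofReal_mul, Complex.exp_ofReal_mul_I_im, Real.sin_neg, mul_neg]
  apply Complex.ext
  · simp only [P, h, C, Complex.re_sum]
  · simp only [P, h, S, Complex.im_sum, Finset.sum_neg_distrib]

theorem P_sq_re {N : ℕ} (a : Fin N → ℝ) (t : ℝ) : (P a t ^ 2).re = C a t ^ 2 - S a t ^ 2 := by
  rw [P_eq, sq, Complex.mul_re]
  ring

theorem P_sq_im {N : ℕ} (a : Fin N → ℝ) (t : ℝ) : (P a t ^ 2).im = -2 * (C a t * S a t) := by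
  rw [P_eq, sq, Complex.mul_im]
  ring

/-- The minimum of `Omega a` is minus the square of the maximum of `zeroValues a`. -/
theorem isLeast_Omega {N : ℕ} {a : Fin N → ℝ} {m : ℝ} (hm : IsGreatest (zeroValues a) m) :
    IsLeast (Omega a) (-m ^ 2) := by
  obtain ⟨⟨t, ht, hC, hy⟩, hub⟩ := hm
  constructor
  · refine ⟨t, ⟨ht.1, by linarith [ht.2, Real.pi_pos]⟩, ?_, ?_⟩
    · rw [P_sq_im, hC]
      ring
    · rw [P_sq_re, hC, hy, sq_abs]
      ring
  · rintro _ ⟨u, hu, him, rfl⟩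
    rw [P_sq_im] at him
    rw [P_sq_re]
    rcases mul_eq_zero.mp ((mul_eq_zero.mp him).resolve_left (by norm_num)) with h | h
    · have h1 := pow_le_pow_left₀ (abs_nonneg _) (hub (abs_S_mem_zeroValues a hu h)) 2
      rw [sq_abs] at h1
      rw [h]
      linarith
    · rw [h]
      linarith [sq_nonneg m, sq_nonneg (C a u)]

/-- The maxima of `zeroValues` are at least `1/N`. -/
theorem one_div_le_of_isGreatest {N : ℕ} (hN : 1 ≤ N) {a : Fin N → ℝ} (ha : ∑ j, a j = 1) {m : ℝ}
    (hm : IsGreatest (zeroValues a) m) : 1 / (N : ℝ) ≤ m := by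
  obtain ⟨τ, hτ, hC, hS⟩ := exists_zero_le_S hN a ha
  exact hS.trans ((le_abs_self _).trans
    (hm.2 (abs_S_mem_zeroValues_of_le_pi a (Set.Ioo_subset_Icc_self hτ) hC)))

/-! ### Odd Fejér coefficients and near-extremal examples. -/

theorem sum_odd_descending (N : ℕ) :
    ∑ j ∈ Finset.range N, (2 * (N : ℝ) - (2 * j + 1)) = N ^ 2 := by
  induction N with
  | zero => simp
  | succ N ih =>
    have h : ∀ j ∈ Finset.range N, (2 * ((N + 1 : ℕ) : ℝ) - (2 * (j : ℝ) + 1))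
        = (2 * (N : ℝ) - (2 * j + 1)) + 2 := fun j _ => by push_cast; ring
    rw [Finset.sum_range_succ, Finset.sum_congr rfl h, Finset.sum_add_distrib, ih]
    simp
    ring

/-- This sum is what the existing terms of the odd Fejér sum gain when `N` grows by one, since each
weight rises by `2`. -/
theorem sin_mul_sum_cos_odd (N : ℕ) (t : ℝ) :
    Real.sin t * (2 * ∑ j ∈ Finset.range N, Real.cos ((2 * (j : ℝ) + 1) * t))
      = Real.sin (2 * (N * t)) := by
  induction N with
  | zero => simp
  | succ N ih =>
    rw [Finset.sum_range_succ, mul_add 2, mul_add, ih]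
    have e1 : (2 * (N : ℝ) + 1) * t = 2 * (N * t) + t := by ring
    have e2 : 2 * (((N + 1 : ℕ) : ℝ) * t) = 2 * (N * t) + 2 * t := by push_cast; ring
    rw [e1, e2, Real.cos_add, Real.sin_add, Real.sin_two_mul t, Real.cos_two_mul t]
    linear_combination -2 * Real.sin (2 * (N * t)) * Real.sin_sq_add_cos_sq t

/-- The odd part of the Fejér kernel of order `2N` in closed form. -/
theorem sin_sq_mul_fejer (N : ℕ) (t : ℝ) :
    Real.sin t ^ 2 *
        ∑ j ∈ Finset.range N, (2 * (N : ℝ) - (2 * j + 1)) * Real.cos ((2 * (j : ℝ) + 1) * t)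
      = Real.sin (N * t) ^ 2 * Real.cos t := by
  induction N with
  | zero => simp
  | succ N ih =>
    have h : ∀ j ∈ Finset.range N,
        (2 * ((N + 1 : ℕ) : ℝ) - (2 * (j : ℝ) + 1)) * Real.cos ((2 * (j : ℝ) + 1) * t)
        = (2 * (N : ℝ) - (2 * j + 1)) * Real.cos ((2 * (j : ℝ) + 1) * t)
          + 2 * Real.cos ((2 * (j : ℝ) + 1) * t) := fun j _ => by push_cast; ring
    rw [Finset.sum_range_succ, Finset.sum_congr rfl h, Finset.sum_add_distrib, ← Finset.mul_sum]
    have h2 := sin_mul_sum_cos_odd N t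
    have e1 : (2 * (N : ℝ) + 1) * t = 2 * (N * t) + t := by ring
    have e2 : ((N + 1 : ℕ) : ℝ) * t = N * t + t := by push_cast; ring
    rw [Real.sin_two_mul] at h2
    rw [e1, e2, Real.cos_add, Real.sin_add, Real.sin_two_mul, Real.cos_two_mul]
    push_cast
    linear_combination ih + Real.sin t * h2 +
      Real.sin t ^ 2 * Real.cos t * Real.sin_sq_add_cos_sq (N * t) -
      (Real.sin (N * t) ^ 2 * Real.cos t + 2 * Real.sin t * Real.sin (N * t) * Real.cos (N * t)) *
        Real.sin_sq_add_cos_sq t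

theorem sum_alternating_odd_descending (N : ℕ) :
    ∑ j ∈ Finset.range N, (2 * (N : ℝ) - (2 * j + 1)) * (-1) ^ j = N := by
  have halt : ∀ N : ℕ, 2 * ∑ j ∈ Finset.range N, (-1 : ℝ) ^ j = 1 - (-1) ^ N := fun N => by
    have := mul_geom_sum (-1 : ℝ) N
    linarith
  induction N with
  | zero => simp
  | succ N ih =>
    have h : ∀ j ∈ Finset.range N, (2 * ((N + 1 : ℕ) : ℝ) - (2 * (j : ℝ) + 1)) * (-1) ^ j
        = (2 * (N : ℝ) - (2 * j + 1)) * (-1) ^ j + 2 * (-1) ^ j := fun j _ => by push_cast; ring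
    rw [Finset.sum_range_succ, Finset.sum_congr rfl h, Finset.sum_add_distrib, ih,
      ← Finset.mul_sum, halt]
    push_cast
    ring

theorem sin_odd_mul_pi_div_two (j : ℕ) :
    Real.sin ((2 * (j : ℝ) + 1) * (Real.pi / 2)) = (-1) ^ j := by
  have e : (2 * (j : ℝ) + 1) * (Real.pi / 2) = Real.pi / 2 + j * Real.pi := by ring
  rw [e, Real.sin_add_nat_mul_pi, Real.sin_pi_div_two, mul_one]

/-- Admissible coefficients for which `π/2` is the only zero of `C` in `[0, π/2]`: a convex
combination of the Fejér coefficients and of `cos t`. -/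
theorem exists_isGreatest_near {N : ℕ} (hN : 1 ≤ N) {ε : ℝ} (h0 : 0 < ε) (h1 : ε < 1) :
    ∃ a : Fin N → ℝ, ∑ j, a j = 1 ∧ IsGreatest (zeroValues a) ((1 - ε) / N + ε) := by
  obtain ⟨M, rfl⟩ : ∃ M, N = M + 1 := ⟨N - 1, by omega⟩
  set K : ℝ := ((M + 1 : ℕ) : ℝ) with hK
  have hKpos : 0 < K := by rw [hK]; positivity
  -- The pure Fejér sum is `sin² (Kt) cos t / sin² t`, which may also vanish at multiples of `π/K`;
  -- the term `ε cos t` makes the factor of `cos t` strictly positive.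
  set a : Fin (M + 1) → ℝ := fun j =>
    (1 - ε) / K ^ 2 * (2 * K - (2 * ((j : ℕ) : ℝ) + 1)) + ε * (if j = 0 then 1 else 0) with ha
  have hlin : ∀ f : ℕ → ℝ, ∑ j : Fin (M + 1), a j * f j
      = (1 - ε) / K ^ 2 * (∑ j ∈ Finset.range (M + 1), (2 * K - (2 * (j : ℝ) + 1)) * f j)
        + ε * f 0 := fun f => by
    rw [← Fin.sum_univ_eq_sum_range (fun j => (2 * K - (2 * (j : ℝ) + 1)) * f j), Finset.mul_sum]
    simp only [ha, add_mul, Finset.sum_add_distrib]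
    congr 1
    · exact Finset.sum_congr rfl fun j _ => by ring
    · simp [ite_mul]
  have hsum : ∑ j, a j = 1 := by
    have := hlin fun _ => 1
    simp only [mul_one] at this
    rw [this, hK, sum_odd_descending, ← hK]
    field_simp
    ring
  have hS : S a (Real.pi / 2) = (1 - ε) / K + ε := by
    have := hlin fun j => Real.sin ((2 * (j : ℝ) + 1) * (Real.pi / 2))
    rw [S, this]
    simp only [sin_odd_mul_pi_div_two]
    rw [hK, sum_alternating_odd_descending, ← hK]
    field_simp
  have hC : ∀ t, Real.sin t ^ 2 * C a t = ((1 - ε) / K ^ 2 * Real.sin (K * t) ^ 2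
      + ε * Real.sin t ^ 2) * Real.cos t := fun t => by
    have := hlin fun j => Real.cos ((2 * (j : ℝ) + 1) * t)
    rw [C, this, mul_add]
    have h2 := sin_sq_mul_fejer (M + 1) t
    rw [← hK] at h2
    simp only [Nat.cast_zero, mul_zero, zero_add, one_mul]
    linear_combination (1 - ε) / K ^ 2 * h2
  have hSnn : 0 ≤ (1 - ε) / K + ε := add_nonneg (div_nonneg (by linarith) hKpos.le) h0.le
  refine ⟨a, hsum, ⟨Real.pi / 2, ⟨by positivity, le_rfl⟩, C_pi_div_two a, ?_⟩, ?_⟩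
  · rw [hS, abs_of_nonneg hSnn]
  · rintro _ ⟨t, ht, hCt, rfl⟩
    rcases ht.1.eq_or_lt with rfl | htpos
    · simp [C, hsum] at hCt
    have hsin : 0 < Real.sin t :=
      Real.sin_pos_of_pos_of_lt_pi htpos (by linarith [ht.2, Real.pi_pos])
    have hcos : Real.cos t = 0 := by
      have h := hC t
      rw [hCt, mul_zero] at h
      refine (mul_eq_zero.mp h.symm).resolve_left (ne_of_gt ?_)
      have : 0 ≤ (1 - ε) / K ^ 2 := div_nonneg (by linarith) (by positivity)
      positivity
    have : t = Real.pi / 2 := by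
      by_contra hne
      exact (Real.cos_pos_of_mem_Ioo ⟨by linarith [Real.pi_pos], lt_of_le_of_ne ht.2 hne⟩).ne' hcos
    rw [this, hS, abs_of_nonneg hSnn]

/-! ### Values of the two extremal problems. -/

theorem tendsto_near (N : ℕ) :
    Filter.Tendsto (fun ε : ℝ => (1 - ε) / N + ε) (nhdsWithin 0 (Set.Ioi 0)) (nhds (1 / N)) := by
  have h : Continuous fun ε : ℝ => (1 - ε) / N + ε := by fun_prop
  simpa using h.continuousWithinAt (s := Set.Ioi 0) (x := 0) |>.tendsto

theorem J_eq {N : ℕ} (hN : 1 ≤ N) : J N = 1 / N := by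
  refine IsGLB.csInf_eq ⟨?_, ?_⟩ ?_
  · rintro m ⟨a, ha, hm⟩
    exact one_div_le_of_isGreatest hN ha hm
  · intro b hb
    refine ge_of_tendsto (tendsto_near N) ?_
    filter_upwards [Ioo_mem_nhdsGT (zero_lt_one' ℝ)] with ε hε
    exact hb (exists_isGreatest_near hN hε.1 hε.2)
  · exact ⟨_, exists_isGreatest_near hN (ε := 1 / 2) (by norm_num) (by norm_num)⟩

theorem I_eq {N : ℕ} (hN : 1 ≤ N) : I N = -(1 / (N : ℝ)) ^ 2 := by
  refine IsLUB.csSup_eq ⟨?_, ?_⟩ ?_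
  · rintro m ⟨a, ha, hm⟩
    obtain ⟨M, hM⟩ := exists_isGreatest_zeroValues a
    rw [hm.unique (isLeast_Omega hM)]
    exact neg_le_neg (pow_le_pow_left₀ (by positivity) (one_div_le_of_isGreatest hN ha hM) 2)
  · intro b hb
    refine le_of_tendsto ((tendsto_near N).pow 2).neg ?_
    filter_upwards [Ioo_mem_nhdsGT (zero_lt_one' ℝ)] with ε hε
    obtain ⟨a, ha, hM⟩ := exists_isGreatest_near hN hε.1 hε.2
    exact hb ⟨a, ha, isLeast_Omega hM⟩
  · obtain ⟨a, ha, hM⟩ := exists_isGreatest_near hN (ε := 1 / 2) (by norm_num) (by norm_num)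
    exact ⟨_, a, ha, isLeast_Omega hM⟩

end CycleStabilization

/-- The first conjunct says that the inner minimum and maximum exist for all admissible
coefficients; the second one is the value of the two extremal problems. -/
theorem mainTheorem1 (N : ℕ) (hN : 1 ≤ N) :
    (∀ a : Fin N → ℝ, ∑ j, a j = 1 →
      (∃ m, IsLeast (CycleStabilization.Omega a) m) ∧
      (∃ m, IsGreatest (CycleStabilization.zeroValues a) m)) ∧
    (-CycleStabilization.I N = CycleStabilization.J N ^ 2 ∧
      CycleStabilization.J N ^ 2 = 1 / (N : ℝ) ^ 2) := by
  refine ⟨fun a _ => ?_, ?_, ?_⟩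
  · obtain ⟨m, hm⟩ := CycleStabilization.exists_isGreatest_zeroValues a
    exact ⟨⟨_, CycleStabilization.isLeast_Omega hm⟩, m, hm⟩
  · rw [CycleStabilization.I_eq hN, CycleStabilization.J_eq hN, neg_neg]
  · rw [CycleStabilization.J_eq hN, div_pow, one_pow]
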